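/- Let $X$ and $Z$ be real Hausdorff locally convex topological vector spaces. Let $C\subseteq Z$ be a convex pointed cone with nonempty interior, that is, $tc\in C$ for all $c\in C$, $t\ge 0$; $C+C=C$; $C\cap(-C)=\{0\}$; and $\operatorname{int} C\neq\emptyset$. Write $z_1\le z_2$ for $z_2-z_1\in C$. Let $K\subseteq X$ be nonempty, convex and compact, and let $D\subseteq K$ be self-segment-dense in $K$: $K\subseteq\operatorname{cl} D$, and for all $x,y\in D$ the set $[x,y]\cap D$ is dense in the closed segment $[x,y]$. A map $g:K\to Z$ is called $C$-upper semicontinuous at $x\in K$ if for every neighborhood $V$ of $g(x)$ there is a neighborhood $U$ of $x$ such that $g(u)\in V-C$ for all $u\in U\cap K$; it is $C$-upper semicontinuous on a subset of $K$ if it is so at each point of that subset. It is called $C$-convex on $D$ if $g\left(\sum_{i=1}^n\lambda_i x_i\right)\le\sum_{i=1}^n\lambda_i g(x_i)$ for all $n\ge 1$, $x_1,\dots,x_n\in D$ and $\lambda_1,\dots,\lambda_n\ge 0$ with $\sum_{i=1}^n\lambda_i=1$ and $\sum_{i=1}^n\lambda_i x_i\in D$. Let $f:K\times K\to Z$ satisfy: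 (i) for every $y\in D$, the map $x\mapsto f(x,y)$ is $C$-upper semicontinuous on $K$; (ii) for every $x\in K$, the map $y\mapsto f(x,y)$ is $C$-upper semicontinuous on $K\setminus D$; (iii) for every $x\in D$, the map $y\mapsto f(x,y)$ is $C$-convex on $D$; (iv) $f(x,x)\notin-\operatorname{int} C$ for every $x\in D$. Then there exists $x_0\in K$ such that $f(x_0,y)\notin-\operatorname{int} C$ for all $y\in K$. -/

import Mathlib

open scoped Topology Pointwise

/-- `U` is self-segment-dense in (the convex set) `V`: `U` is a subset of `V`, it is dense in `V`,
and for all `x, y ∈ U` the set `[x, y] ∩ U` is dense in the closed segment `[x, y]`. -/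
structure IsSelfSegmentDense {X : Type*} [AddCommGroup X] [Module ℝ X] [TopologicalSpace X]
    (U V : Set X) : Prop where
  subset : U ⊆ V
  dense : V ⊆ closure U
  segment_dense : ∀ x ∈ U, ∀ y ∈ U, segment ℝ x y ⊆ closure (segment ℝ x y ∩ U)

/-- A map `g : K → Z` is `C`-upper semicontinuous at `x ∈ K`: every neighbourhood `V` of `g x`
admits a neighbourhood `U` of `x` such that `g u ∈ V - C` for all `u ∈ U ∩ K`.
As usual, `g` is given as a total function of which only the values on `K` matter. -/
def IsConeUpperSemicontinuousAt {X Z : Type*} [TopologicalSpace X]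
    [AddCommGroup Z] [TopologicalSpace Z]
    (C : Set Z) (K : Set X) (g : X → Z) (x : X) : Prop :=
  ∀ V ∈ 𝓝 (g x), ∃ U ∈ 𝓝 x, ∀ u ∈ U ∩ K, g u ∈ V - C

/-- A map `g` is `C`-convex on a (not necessarily convex) set `D`: Jensen's inequality
`g (∑ lᵢ xᵢ) ≤ ∑ lᵢ g (xᵢ)` holds for all finite convex combinations of points of `D` that
belong to `D`, where `z₁ ≤ z₂` means `z₂ - z₁ ∈ C`. -/
def IsConeConvexOn {X Z : Type*} [AddCommGroup X] [Module ℝ X] [AddCommGroup Z] [Module ℝ Z]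
    (C : Set Z) (D : Set X) (g : X → Z) : Prop :=
  ∀ (n : ℕ) (x : Fin n → X) (l : Fin n → ℝ), (∀ i, x i ∈ D) → (∀ i, 0 ≤ l i) → ∑ i, l i = 1 →
    ∑ i, l i • x i ∈ D → ∑ i, l i • g (x i) - g (∑ i, l i • x i) ∈ C

/-! If every `x` in `K` has some `y ∈ D` with `f x y ∈ -int C`, then by upper semicontinuity in `x`
the sets of such `x`, for `y ∈ D`, form a relatively open cover of `K`. A dual KKM theorem on a
simplex gives a point in the convex hull of finitely many indices, all of whose sets contain it.
Self-segment-density makes `D` dense in that hull, so the point moves into `D` without leaving these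
open sets (`IsSelfSegmentDense.exists_mem_convexHull`). Then `C`-convexity puts `f x x` in `-int C`,
a contradiction. Density of `D` and semicontinuity in `y` pass from `D` to `K`.

Dual KKM follows from Scarf's theorem on fine finite nets: dominating sets replace the cells of a
triangulation, and a parity count as in Sperner's lemma yields a colourful one. -/

section Scarf

/-! ### Scarf's combinatorial theorem -/

variable {V I L : Type*} [LinearOrder L]

/-- A finite set `S` is dominating for a family of orders on `V` when no element of `V` lies,
for all orders at once, strictly above the minimum of `S`. -/
def IsDominating (r : I → V → L) (S : Finset V) : Prop :=
  ∀ y, ∃ i, ∀ s ∈ S, r i y ≤ r i s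

lemma IsDominating.mono {r : I → V → L} {S T : Finset V} (hT : IsDominating r T) (h : S ⊆ T) :
    IsDominating r S := fun y => (hT y).imp fun _ hi s hs => hi s (h hs)

lemma exists_min_selector (r : I → V → L) {S : Finset V} (hS : S.Nonempty) :
    ∃ m : I → V, (∀ i, m i ∈ S) ∧ ∀ i, ∀ v ∈ S, r i (m i) ≤ r i v := by
  choose m hm using fun i => S.exists_min_image (r i) hS
  exact ⟨m, fun i => (hm i).1, fun i => (hm i).2⟩

lemma IsDominating.exists_min_eq {r : I → V → L} (hr : ∀ i, Function.Injective (r i))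
    {S : Finset V} (hS : IsDominating r S) {m : I → V} (hm : ∀ i, m i ∈ S)
    (hmin : ∀ i, ∀ v ∈ S, r i (m i) ≤ r i v) {a : V} (ha : a ∈ S) : ∃ i, m i = a := by
  obtain ⟨i, hi⟩ := hS a
  exact ⟨i, hr i (le_antisymm (hmin i a ha) (hi _ (hm i)))⟩

variable [DecidableEq V]

lemma IsDominating.min_injective [Fintype I] {r : I → V → L}
    (hr : ∀ i, Function.Injective (r i))
    {S : Finset V} (hS : IsDominating r S) (hcard : S.card = Fintype.card I)
    {m : I → V} (hm : ∀ i, m i ∈ S)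
    (hmin : ∀ i, ∀ v ∈ S, r i (m i) ≤ r i v) : Function.Injective m := by
  have h : Finset.univ.image m = S := by
    ext a
    simp only [Finset.mem_image, Finset.mem_univ, true_and]
    exact ⟨fun ⟨i, hi⟩ => hi ▸ hm i, fun ha => hS.exists_min_eq hr hm hmin ha⟩
  have h2 := (Finset.card_image_iff (s := Finset.univ) (f := m)).1 (by rw [h, hcard]; rfl)
  exact fun a b hab => h2 (by simp) (by simp) hab

/-- The minima of `insert z S` correspond bijectively to the orders; `k` is the order minimised at
`z`, and the other minima are unchanged. Hence `k` determines `z`, and `m` repeats just one value,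
at `k` and one other index. -/
lemma IsDominating.exists_index_of_insert [Fintype I] {r : I → V → L}
    (hr : ∀ i, Function.Injective (r i)) {S : Finset V} (hcard : S.card + 1 = Fintype.card I)
    {m : I → V} (hm : ∀ i, m i ∈ S) (hmin : ∀ i, ∀ v ∈ S, r i (m i) ≤ r i v)
    {z : V} (hz : z ∉ S) (hdom : IsDominating r (insert z S)) :
    ∃ k, (∀ l, l ≠ k → r l (m l) < r l z) ∧
      (∀ y, (∀ l, l ≠ k → r l (m l) < r l y) → r k y ≤ r k z) ∧
      (∀ l, l ≠ k → ∀ l', l' ≠ k → m l = m l' → l = l') ∧ ∀ a ∈ S, ∃ l, l ≠ k ∧ m l = a := by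
  obtain ⟨m', hm', hmin'⟩ := exists_min_selector r (Finset.insert_nonempty z S)
  have hinj := hdom.min_injective hr (by rw [Finset.card_insert_of_notMem hz, hcard]) hm' hmin'
  obtain ⟨k, hk⟩ := hdom.exists_min_eq hr hm' hmin' (Finset.mem_insert_self z S)
  have heq : ∀ l, l ≠ k → m' l = m l := by
    intro l hl
    have h1 : m' l ∈ S := by
      rcases Finset.mem_insert.1 (hm' l) with h | h
      · exact absurd (hinj (h.trans hk.symm)) hl
      · exact h
    exact hr l (le_antisymm (hmin' l _ (Finset.mem_insert_of_mem (hm l))) (hmin l _ h1))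
  have hlt : ∀ l, l ≠ k → r l (m l) < r l z := by
    intro l hl
    refine lt_of_le_of_ne ?_ fun h => hz (hr l h ▸ hm l)
    rw [← heq l hl]
    exact hmin' l z (Finset.mem_insert_self z S)
  refine ⟨k, hlt, ?_, ?_, ?_⟩
  · intro y hy
    obtain ⟨i, hi⟩ := hdom y
    rcases eq_or_ne i k with rfl | hik
    · exact hi z (Finset.mem_insert_self z S)
    · exact absurd (hi (m i) (Finset.mem_insert_of_mem (hm i))) (not_le.2 (hy i hik))
  · intro l hl l' hl' h
    rw [← heq l hl, ← heq l' hl'] at h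
    exact hinj h
  · intro a ha
    obtain ⟨l, hl⟩ := hdom.exists_min_eq hr hm' hmin' (Finset.mem_insert_of_mem ha)
    have hlk : l ≠ k := by
      rintro rfl
      exact hz (hk.symm.trans hl ▸ ha)
    exact ⟨l, hlk, (heq l hlk).symm.trans hl⟩

/-- `S` dominates `z`, which can only happen at `k`, so `z` is the new minimum there. Any `y` is
blocked at `k` by maximality, or at some `l ≠ k` by the old minimum. -/
lemma IsDominating.insert_of_isMax {r : I → V → L} {S : Finset V}
    (hS : IsDominating r S) {m : I → V} (hm : ∀ i, m i ∈ S)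
    (hmin : ∀ i, ∀ v ∈ S, r i (m i) ≤ r i v) {k : I}
    (hsurj : ∀ a ∈ S, ∃ l, l ≠ k ∧ m l = a) {z : V} (hz : ∀ l, l ≠ k → r l (m l) < r l z)
    (hmax : ∀ y, (∀ l, l ≠ k → r l (m l) < r l y) → r k y ≤ r k z) :
    z ∉ S ∧ IsDominating r (insert z S) := by
  constructor
  · intro h
    obtain ⟨l, hl, rfl⟩ := hsurj z h
    exact lt_irrefl _ (hz l hl)
  have hzk : ∀ s ∈ S, r k z ≤ r k s := by
    obtain ⟨i, hi⟩ := hS z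
    rcases eq_or_ne i k with rfl | hik
    · exact hi
    · exact absurd (hi (m i) (hm i)) (not_le.2 (hz i hik))
  intro y
  by_cases hy : ∀ l, l ≠ k → r l (m l) < r l y
  · refine ⟨k, fun s hs => ?_⟩
    rcases Finset.mem_insert.1 hs with rfl | hs
    · exact hmax y hy
    · exact (hmax y hy).trans (hzk s hs)
  · push Not at hy
    obtain ⟨l, hl, hle⟩ := hy
    refine ⟨l, fun s hs => hle.trans ?_⟩
    rcases Finset.mem_insert.1 hs with rfl | hs
    exacts [(hz l hl).le, hmin l s hs]

open Classical in
/-- The number of ways to drop an element of `S` so that the remaining ones carry all colours but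
`i`, each once, is even unless `S` carries all colours. -/
lemma even_card_removals [Fintype I] (c : V → I) (i : I) {S : Finset V} (hcard : S.card = Fintype.card I)
    (hS : S.image c ≠ Finset.univ) :
    Even (S.filter fun x => (S.erase x).image c = Finset.univ.erase i).card := by
  rcases Finset.eq_empty_or_nonempty
    (S.filter fun x => (S.erase x).image c = Finset.univ.erase i) with h | ⟨x, hx⟩
  · simp [h]
  have hinj : ∀ x ∈ S, (S.erase x).image c = Finset.univ.erase i →
      Set.InjOn c (S.erase x : Finset V) := by
    intro x hx h
    refine Finset.card_image_iff.1 ?_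
    rw [h, Finset.card_erase_of_mem (Finset.mem_univ _), Finset.card_erase_of_mem hx, hcard]
    rfl
  obtain ⟨hxS, hx⟩ := Finset.mem_filter.1 hx
  -- Otherwise restoring `x` would complete the colours. So `x` shares its colour with another `y`,
  -- and only these two can be dropped.
  have hcx : c x ≠ i := by
    intro hci
    apply hS
    rw [← Finset.insert_erase hxS, Finset.image_insert, hx, hci,
      Finset.insert_erase (Finset.mem_univ _)]
  obtain ⟨y, hy, hyx⟩ := Finset.mem_image.1 (hx ▸ Finset.mem_erase.2 ⟨hcx, Finset.mem_univ _⟩)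
  obtain ⟨hyne, hyS⟩ := Finset.mem_erase.1 hy
  refine ⟨1, ?_⟩
  refine Finset.card_eq_two.2 ⟨x, y, hyne.symm, ?_⟩
  ext w
  simp only [Finset.mem_filter, Finset.mem_insert, Finset.mem_singleton]
  constructor
  · rintro ⟨hw, hw'⟩
    by_contra! h
    exact hyne (hinj w hw hw' (by simp [hyS, h.2.symm]) (by simp [hxS, h.1.symm]) hyx)
  · rintro (rfl | rfl)
    · exact ⟨hxS, hx⟩
    · refine ⟨hyS, ?_⟩
      rw [← hx, ← Finset.insert_erase (Finset.mem_erase.2 ⟨hyne.symm, hxS⟩),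
        ← Finset.insert_erase hy, Finset.image_insert, Finset.image_insert, hyx,
        Finset.erase_right_comm]

variable [Fintype V] [Fintype I] {r : I → V → L} {e : I → V}

open Classical in
/-- A set one element short of a dominating set of full size, other than a set of slack elements,
has either no or exactly two completions to a dominating set. -/
lemma card_completions_eq_two (hr : ∀ i, Function.Injective (r i))
    (hlow : ∀ i v, v ≠ e i → r i (e i) < r i v)
    (hhigh : ∀ i j v, j ≠ i → v ∉ Set.range e → r i v < r i (e j))
    {S : Finset V} (hcard : S.card + 1 = Fintype.card I) {t : V} (ht : t ∈ S)
    (hte : t ∉ Set.range e) {x : V} (hx : x ∉ S) (hdom : IsDominating r (insert x S)) :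
    (Finset.univ.filter fun z => z ∉ S ∧ IsDominating r (insert z S)).card = 2 := by
  have hS : IsDominating r S := hdom.mono (Finset.subset_insert x S)
  obtain ⟨m, hm, hmin⟩ := exists_min_selector r ⟨t, ht⟩
  obtain ⟨i, hxi, hximax, hinj, hsurj⟩ :=
    IsDominating.exists_index_of_insert hr hcard hm hmin hx hdom
  -- The repeated value of `m` is at `i` and `j`, so a completion must free one of them: `x` frees
  -- `i`, and the `z` below frees `j`.
  obtain ⟨j, hji, hmj⟩ := hsurj (m i) (hm i)
  have hsurj' : ∀ a ∈ S, ∃ l, l ≠ j ∧ m l = a := by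
    intro a ha
    obtain ⟨l, hl, hla⟩ := hsurj a ha
    rcases eq_or_ne l j with rfl | hlj
    · exact ⟨i, hji.symm, hmj.symm.trans hla⟩
    · exact ⟨l, hlj, hla⟩
  -- This makes `e j` a candidate for `z`; the non-slack `t` prevents `m l` from being a slack other
  -- than `e l`.
  have hslack : ∀ l, l ≠ j → r l (m l) < r l (e j) := by
    intro l hl
    by_cases hml : m l ∈ Set.range e
    · obtain ⟨p, hp⟩ := hml
      rcases eq_or_ne p l with rfl | hpl
      · rw [← hp]
        refine hlow p (e j) fun h => ?_
        have := hhigh p j t hl.symm hte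
        rw [h] at this
        exact lt_asymm this (hlow p t fun h' => hte ⟨p, h'.symm⟩)
      · have h1 := hhigh l p t hpl hte
        rw [hp] at h1
        exact absurd (hmin l t ht) (not_le.2 h1)
    · exact hhigh l j _ hl.symm hml
  obtain ⟨z, hz, hzmax⟩ := (Finset.univ.filter fun y => ∀ l, l ≠ j → r l (m l) < r l y).exists_max_image
    (r j) ⟨e j, by simpa using hslack⟩
  simp only [Finset.mem_filter, Finset.mem_univ, true_and] at hz hzmax
  have hzS := hS.insert_of_isMax hm hmin hsurj' hz hzmax
  have hxz : x ≠ z := by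
    rintro rfl
    obtain ⟨l, hl⟩ := hS x
    rcases eq_or_ne l i with rfl | hli
    · exact not_le.2 (hz l hji.symm) (hl _ (hm l))
    · exact not_le.2 (hxi l hli) (hl _ (hm l))
  refine Finset.card_eq_two.2 ⟨x, z, hxz, ?_⟩
  ext w
  simp only [Finset.mem_filter, Finset.mem_univ, true_and, Finset.mem_insert, Finset.mem_singleton]
  constructor
  · rintro ⟨hw, hwdom⟩
    obtain ⟨k, hk, hkmax, hkinj, -⟩ :=
      IsDominating.exists_index_of_insert hr hcard hm hmin hw hwdom
    rcases eq_or_ne k i with rfl | hki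
    · exact Or.inl (hr k (le_antisymm (hximax w hk) (hkmax x hxi)))
    rcases eq_or_ne k j with rfl | hkj
    · exact Or.inr (hr k (le_antisymm (hzmax w hk) (hkmax z hz)))
    exact absurd (hkinj j hkj.symm i hki.symm hmj) hji
  · rintro (rfl | rfl)
    exacts [⟨hx, hdom⟩, hzS]

open Classical in
/-- The set of all slack elements but one has exactly one completion to a dominating set. -/
lemma card_completions_slack_eq_one [Nonempty V] (hr : ∀ i, Function.Injective (r i))
    (hlow : ∀ i v, v ≠ e i → r i (e i) < r i v)
    (hhigh : ∀ i j v, j ≠ i → v ∉ Set.range e → r i v < r i (e j))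
    (hne : ∃ t, t ∉ Set.range e) (i : I) :
    (Finset.univ.filter fun z => z ∉ (Finset.univ.erase i).image e ∧
      IsDominating r (insert z ((Finset.univ.erase i).image e))).card = 1 := by
  set S := (Finset.univ.erase i).image e with hSdef
  have hS : ∀ j, j ≠ i → e j ∈ S := fun j hj => Finset.mem_image_of_mem e (by simp [hj])
  have hS' : ∀ v ∈ S, ∃ j, j ≠ i ∧ e j = v := by simp [hSdef]
  have hSr : ∀ v, v ∉ Set.range e → v ∉ S := fun v hv h => by
    obtain ⟨j, -, rfl⟩ := hS' v h
    exact hv ⟨j, rfl⟩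
  obtain ⟨z, hz, hzmax⟩ := (Finset.univ.filter fun y => y ∉ Set.range e).exists_max_image
    (r i) (by obtain ⟨t, ht⟩ := hne; exact ⟨t, by simpa using ht⟩)
  simp only [Finset.mem_filter, Finset.mem_univ, true_and] at hz hzmax
  have hzlow : ∀ l, ∀ v, v ∉ Set.range e → r l (e l) < r l v :=
    fun l v hv => hlow l v fun h => hv ⟨l, h.symm⟩
  refine Finset.card_eq_one.2 ⟨z, ?_⟩
  ext w
  simp only [Finset.mem_filter, Finset.mem_univ, true_and, Finset.mem_singleton]
  constructor
  · rintro ⟨hw, hdom⟩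
    -- Only order `i` can dominate `z`: for every other order the set contains its bottom element.
    obtain ⟨l, hl⟩ := hdom z
    obtain rfl : l = i := by
      by_contra hli
      exact not_le.2 (hzlow l z hz) (hl _ (Finset.mem_insert_of_mem (hS l hli)))
    have hwr : w ∉ Set.range e := by
      rintro ⟨p, rfl⟩
      rcases eq_or_ne p l with rfl | hp
      · exact not_le.2 (hzlow p z hz) (hl _ (Finset.mem_insert_self _ _))
      · exact hw (hS p hp)
    exact hr l (le_antisymm (hzmax w hwr) (hl w (Finset.mem_insert_self _ _)))
  · rintro rfl
    refine ⟨hSr _ hz, fun y => ?_⟩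
    by_cases hy : y ∈ Set.range e
    · obtain ⟨p, rfl⟩ := hy
      refine ⟨p, fun s _ => ?_⟩
      rcases eq_or_ne s (e p) with rfl | h
      exacts [le_rfl, (hlow p s h).le]
    · refine ⟨i, fun s hs => ?_⟩
      rcases Finset.mem_insert.1 hs with rfl | hs
      · exact hzmax y hy
      · obtain ⟨j, hj, rfl⟩ := hS' s hs
        exact (hhigh i j y hj hy).le

/-- **Scarf's combinatorial theorem**: for every colouring of the vertices in which the slack
elements have their own colours, some dominating set carries all colours, each of them once. -/
theorem exists_colourful_dominating (hr : ∀ i, Function.Injective (r i))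
    (hlow : ∀ i v, v ≠ e i → r i (e i) < r i v)
    (hhigh : ∀ i j v, j ≠ i → v ∉ Set.range e → r i v < r i (e j))
    (hne : ∃ t, t ∉ Set.range e) [Nonempty I] (c : V → I) (hc : ∀ i, c (e i) = i) :
    ∃ S : Finset V, IsDominating r S ∧ S.card = Fintype.card I ∧ ∀ i, ∃ v ∈ S, c v = i := by
  classical
  by_contra! hcon
  have : Nonempty V := ⟨hne.choose⟩
  obtain ⟨i⟩ := ‹Nonempty I›
  -- Pairs (set, dropped element) are counted twice. Without a colourful set the count over `R` is
  -- even; over `Q` the all-slack set contributes one and every other set zero or two.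
  let R : Finset (Finset V) :=
    Finset.univ.filter fun S => S.card = Fintype.card I ∧ IsDominating r S
  let Q : Finset (Finset V) :=
    Finset.univ.filter fun S => S.card + 1 = Fintype.card I ∧ S.image c = Finset.univ.erase i
  let removals : Finset V → Finset V :=
    fun S => S.filter fun x => (S.erase x).image c = Finset.univ.erase i
  let completions : Finset V → Finset V :=
    fun S => Finset.univ.filter fun z => z ∉ S ∧ IsDominating r (insert z S)
  have hcount : ∑ S ∈ R, (removals S).card = ∑ S ∈ Q, (completions S).card := by
    rw [← Finset.card_sigma, ← Finset.card_sigma]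
    refine Finset.card_nbij' (fun p => ⟨p.1.erase p.2, p.2⟩) (fun p => ⟨insert p.2 p.1, p.2⟩)
      ?_ ?_ ?_ ?_
    · rintro ⟨S, x⟩ h
      simp only [Finset.coe_sigma, Set.mem_sigma_iff, Finset.mem_coe, Finset.mem_filter,
        Finset.mem_univ, true_and, R, Q, removals, completions] at h ⊢
      obtain ⟨⟨h1, h2⟩, h3, h4⟩ := h
      rw [Finset.card_erase_add_one h3, Finset.insert_erase h3]
      exact ⟨⟨h1, h4⟩, by simp, h2⟩
    · rintro ⟨S, x⟩ h
      simp only [Finset.coe_sigma, Set.mem_sigma_iff, Finset.mem_coe, Finset.mem_filter,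
        Finset.mem_univ, true_and, R, Q, removals, completions] at h ⊢
      obtain ⟨⟨h1, h2⟩, h3, h4⟩ := h
      rw [Finset.card_insert_of_notMem h3, Finset.erase_insert h3]
      exact ⟨⟨h1, h4⟩, by simp, h2⟩
    · rintro ⟨S, x⟩ h
      simp only [Finset.coe_sigma, Set.mem_sigma_iff, Finset.mem_coe, Finset.mem_filter,
        Finset.mem_univ, true_and, R, removals] at h ⊢
      rw [Finset.insert_erase h.2.1]
    · rintro ⟨S, x⟩ h
      simp only [Finset.coe_sigma, Set.mem_sigma_iff, Finset.mem_coe, Finset.mem_filter,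
        Finset.mem_univ, true_and, Q, completions] at h ⊢
      rw [Finset.erase_insert h.2.1]
  have heven : Even (∑ S ∈ R, (removals S).card) := by
    refine Finset.even_sum _ fun S hS => ?_
    obtain ⟨h1, h2⟩ := (Finset.mem_filter.1 hS).2
    refine even_card_removals c i h1 fun h => ?_
    obtain ⟨j, hj⟩ := hcon S h2 h1
    obtain ⟨v, hv, hvj⟩ := Finset.mem_image.1 (h ▸ Finset.mem_univ j)
    exact hj v hv hvj
  have hinj : Function.Injective e := fun a b h => by rw [← hc a, h, hc b]
  set S₀ : Finset V := (Finset.univ.erase i).image e with hS₀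
  have hS₀Q : S₀ ∈ Q := by
    refine Finset.mem_filter.2 ⟨Finset.mem_univ _, ?_, ?_⟩
    · rw [Finset.card_image_of_injective _ hinj, Finset.card_erase_add_one (Finset.mem_univ _)]
      rfl
    · rw [hS₀, Finset.image_image]
      simp [Function.comp_def, hc]
  have hrest : Even (∑ S ∈ Q.erase S₀, (completions S).card) := by
    refine Finset.even_sum _ fun S hS => ?_
    obtain ⟨hSne, hS⟩ := Finset.mem_erase.1 hS
    obtain ⟨h1, h2⟩ := (Finset.mem_filter.1 hS).2
    rcases Finset.eq_empty_or_nonempty (completions S) with h | ⟨x, hx⟩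
    · simp [h]
    obtain ⟨hx1, hx2⟩ := (Finset.mem_filter.1 hx).2
    have ht : ∃ t ∈ S, t ∉ Set.range e := by
      by_contra! h
      refine hSne (Finset.eq_of_subset_of_card_le (fun v hv => ?_) ?_)
      · obtain ⟨p, rfl⟩ := h v hv
        refine Finset.mem_image_of_mem e ?_
        rw [← h2]
        exact Finset.mem_image.2 ⟨_, hv, hc p⟩
      · have := (Finset.mem_filter.1 hS₀Q).2.1
        omega
    obtain ⟨t, ht, hte⟩ := ht
    exact ⟨1, card_completions_eq_two hr hlow hhigh h1 ht hte hx1 hx2⟩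
  have hone : (completions S₀).card = 1 := card_completions_slack_eq_one hr hlow hhigh hne i
  rw [hcount, ← Finset.add_sum_erase _ _ hS₀Q, hone, add_comm, Nat.even_add_one] at heven
  exact heven hrest

end Scarf

/-! ### The dual KKM theorem on the simplex -/

section DualKKM

variable {I : Type*} [Fintype I]

/-- Scarf's theorem for a finite set of points of `I → ℝ`, ordered by their coordinates: there is
a set `J` of colours and a finite set `A` of points carrying these colours such that no point of `T`
exceeds in all coordinates of `J` the minimum over `A`. -/
lemma exists_colourful_points [Nonempty I] (T : Finset (I → ℝ)) (hT : T.Nonempty)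
    (h0 : ∀ x ∈ T, ∀ i, 0 ≤ x i) (h1 : ∀ x ∈ T, ∀ i, x i ≤ 1) (c : (I → ℝ) → I) :
    ∃ (J : Finset I) (A : Finset (I → ℝ)), A.Nonempty ∧ A ⊆ T ∧ (∀ i ∈ J, ∃ a ∈ A, c a = i) ∧
      ∀ y ∈ T, ∃ i ∈ J, ∀ a ∈ A, y i ≤ a i := by
  classical
  let V := T ⊕ I
  let idx : V → ℕ := fun v => (Fintype.equivFin V v : ℕ)
  have hidx : Function.Injective idx := fun a b h =>
    (Fintype.equivFin V).injective (Fin.ext h)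
  -- The slack values -1 and 2 lie on either side of `[0, 1]`; the index in `r` breaks ties.
  let g : I → V → ℝ := fun i => Sum.elim (fun t => t.1 i) (fun j => if j = i then -1 else 2)
  let r : I → V → ℝ ×ₗ ℕ := fun i v => toLex (g i v, idx v)
  let col : V → I := Sum.elim (fun t => c t.1) id
  have hlt : ∀ i v w, g i v < g i w → r i v < r i w := fun i v w h => Prod.Lex.toLex_lt_toLex.2 (Or.inl h)
  have hle : ∀ i v w, r i v ≤ r i w → g i v ≤ g i w := by
    intro i v w h
    by_contra! h'
    exact not_le.2 (hlt i w v h') h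
  have hg : ∀ i (t : T), g i (Sum.inl t) = t.1 i := fun _ _ => rfl
  have hgs : ∀ i, g i (Sum.inr i) = -1 := fun i => if_pos rfl
  have hgn : ∀ i j, j ≠ i → g i (Sum.inr j) = 2 := fun i j h => if_neg h
  have hlow : ∀ i v, v ≠ Sum.inr i → r i (Sum.inr i) < r i v := by
    rintro i (t | j) hv
    · refine hlt _ _ _ ?_
      rw [hgs, hg]
      linarith [h0 t.1 t.2 i]
    · refine hlt _ _ _ ?_
      rw [hgs, hgn i j fun h => hv (h ▸ rfl)]
      norm_num
  obtain ⟨S, hdom, -, hS⟩ := exists_colourful_dominating (r := r) (e := Sum.inr)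
    (fun i a b h => hidx (Prod.ext_iff.1 (toLex.injective h)).2) hlow
    (by
      rintro i j (t | k) hj hv
      · refine hlt _ _ _ ?_
        rw [hgn i j hj, hg]
        linarith [h1 t.1 t.2 i]
      · exact absurd ⟨k, rfl⟩ hv)
    (by obtain ⟨t, ht⟩ := hT; exact ⟨Sum.inl ⟨t, ht⟩, by simp⟩) col (fun _ => rfl)
  have hdom' : ∀ y ∈ T, ∃ i, Sum.inr i ∉ S ∧ ∀ a (ha : a ∈ T), Sum.inl ⟨a, ha⟩ ∈ S → y i ≤ a i := by
    intro y hy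
    obtain ⟨i, hi⟩ := hdom (Sum.inl ⟨y, hy⟩)
    refine ⟨i, fun h => ?_, fun a ha haS => hle _ _ _ (hi _ haS)⟩
    have := hle _ _ _ (hi _ h)
    rw [hgs, hg] at this
    linarith [h0 y hy i]
  refine ⟨Finset.univ.filter fun i => Sum.inr i ∉ S,
    T.filter fun a => ∃ ha : a ∈ T, Sum.inl ⟨a, ha⟩ ∈ S, ?_, Finset.filter_subset _ _, ?_, ?_⟩
  · obtain ⟨t, ht⟩ := hT
    obtain ⟨i, hi, -⟩ := hdom' t ht
    obtain ⟨v | j, hv, hvi⟩ := hS i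
    · exact ⟨v.1, by simpa using hv⟩
    · exact absurd hv (by rwa [show j = i from hvi])
  · intro i hi
    obtain ⟨v | j, hv, hvi⟩ := hS i
    · exact ⟨v.1, by simpa using hv, hvi⟩
    · exact absurd hv (by rw [show j = i from hvi]; simpa using hi)
  · intro y hy
    obtain ⟨i, hi, hi'⟩ := hdom' y hy
    refine ⟨i, by simpa using hi, fun a ha => ?_⟩
    obtain ⟨ha, ha', h⟩ := Finset.mem_filter.1 ha
    exact hi' a ha' h

/-- In a fine net of the standard simplex, the set provided by Scarf's theorem is small and close
to the face spanned by its colours. -/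
lemma exists_nearly_colourful_point [Nonempty I] (c : (I → ℝ) → I) {δ : ℝ} (hδ : 0 < δ) :
    ∃ x ∈ stdSimplex ℝ I, ∀ i, x i < δ ∨ ∃ a ∈ stdSimplex ℝ I, c a = i ∧ dist a x < δ := by
  classical
  set N : ℝ := (Fintype.card I : ℝ) with hN
  have hNpos : 0 < N := by
    rw [hN]
    exact_mod_cast Fintype.card_pos
  obtain ⟨T, hTsub, hTfin, hTcov⟩ := (isCompact_stdSimplex ℝ I).finite_cover_balls
    (e := δ / (2 * N)) (by positivity)
  lift T to Finset (I → ℝ) using hTfin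
  have hT : T.Nonempty := by
    obtain ⟨t, ht, -⟩ := Set.mem_iUnion₂.1 (hTcov (single_mem_stdSimplex ℝ (Classical.arbitrary I)))
    exact ⟨t, ht⟩
  have hle1 : ∀ x ∈ stdSimplex ℝ I, ∀ i, x i ≤ 1 := fun x hx i =>
    hx.2 ▸ Finset.single_le_sum (f := x) (fun j _ => hx.1 j) (Finset.mem_univ i)
  obtain ⟨J, A, hA, hAT, hJ, hdom⟩ := exists_colourful_points T hT
    (fun x hx => (hTsub hx).1) (fun x hx => hle1 x (hTsub hx)) c
  have hAs : ∀ a ∈ A, a ∈ stdSimplex ℝ I := fun a ha => hTsub (hAT ha)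
  choose m hmA hm using fun i : I => A.exists_min_image (fun a => a i) hA
  have hJne : J.Nonempty := by
    obtain ⟨t, ht⟩ := hT
    obtain ⟨i, hi, -⟩ := hdom t ht
    exact ⟨i, hi⟩
  have hJN : (J.card : ℝ) ≤ N := by
    rw [hN]
    exact_mod_cast Finset.card_le_univ J
  have hJpos : (0 : ℝ) < J.card := by exact_mod_cast hJne.card_pos
  -- Otherwise spreading the deficit evenly over `J` gives a point exceeding each minimum by at
  -- least `δ / N`; a net point within `δ / (2 * N)` of it is then not dominated.
  have hsum : 1 - δ < ∑ i ∈ J, m i i := by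
    by_contra! hlt
    set η : ℝ := (1 - ∑ i ∈ J, m i i) / J.card with hη
    have hηδ : δ / N ≤ η := by
      rw [hη, div_le_div_iff₀ hNpos hJpos]
      nlinarith
    have hηpos : 0 < η := lt_of_lt_of_le (by positivity) hηδ
    let y : I → ℝ := fun i => if i ∈ J then m i i + η else 0
    have hy : y ∈ stdSimplex ℝ I := by
      constructor
      · intro i
        by_cases hi : i ∈ J
        · simp only [y, hi, if_true]
          linarith [(hAs _ (hmA i)).1 i]
        · simp [y, hi]
      · simp only [y, Finset.sum_ite_mem, Finset.univ_inter, Finset.sum_add_distrib,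
          Finset.sum_const, nsmul_eq_mul]
        rw [hη]
        field_simp
        ring
    obtain ⟨t, ht, hyt⟩ := Set.mem_iUnion₂.1 (hTcov hy)
    obtain ⟨i, hi, hle⟩ := hdom t ht
    have h1 : |y i - t i| < δ / (2 * N) :=
      (dist_le_pi_dist y t i).trans_lt (Metric.mem_ball.1 hyt)
    have h2 : y i = m i i + η := if_pos hi
    have h3 := hle _ (hmA i)
    have h4 : δ / (2 * N) < δ / N := by
      rw [div_lt_div_iff₀ (by positivity) hNpos]
      nlinarith
    have h5 := (abs_lt.1 h1).2
    linarith
  have hJbound : ∀ a ∈ A, ∀ i ∈ J, a i < m i i + δ := by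
    intro a ha i hi
    have h1 : ∑ j ∈ J, (a j - m j j) ≤ 1 - ∑ j ∈ J, m j j := by
      rw [Finset.sum_sub_distrib, ← (hAs a ha).2]
      gcongr
      · exact fun j _ _ => (hAs a ha).1 j
      · exact Finset.subset_univ J
    have h2 := Finset.single_le_sum (f := fun j => a j - m j j)
      (fun j _ => sub_nonneg.2 (hm j a ha)) hi
    linarith
  have hout : ∀ a ∈ A, ∀ i, i ∉ J → a i < δ := by
    intro a ha i hi
    have h1 : ∑ j ∈ insert i J, a j ≤ 1 := by
      rw [← (hAs a ha).2]
      exact Finset.sum_le_sum_of_subset_of_nonneg (Finset.subset_univ _)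
        fun j _ _ => (hAs a ha).1 j
    rw [Finset.sum_insert hi] at h1
    have h2 : ∑ j ∈ J, m j j ≤ ∑ j ∈ J, a j := Finset.sum_le_sum fun j _ => hm j a ha
    linarith
  obtain ⟨x, hx⟩ := hA
  refine ⟨x, hAs x hx, fun i => ?_⟩
  by_cases hi : i ∈ J
  · obtain ⟨a, ha, hai⟩ := hJ i hi
    refine Or.inr ⟨a, hAs a ha, hai, (dist_pi_lt_iff hδ).2 fun j => ?_⟩
    rw [Real.dist_eq, abs_lt]
    by_cases hj : j ∈ J
    · have h1 := hJbound a ha j hj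
      have h2 := hJbound x hx j hj
      have h3 := hm j a ha
      have h4 := hm j x hx
      constructor <;> linarith
    · have h1 := hout a ha j hj
      have h2 := hout x hx j hj
      have h3 := (hAs a ha).1 j
      have h4 := (hAs x hx).1 j
      constructor <;> linarith
  · exact Or.inl (hout x hx i hi)

/-- The dual form of the Knaster-Kuratowski-Mazurkiewicz theorem: if closed sets `F i` cover the
standard simplex, some point of it lies in `F i` for every `i` in its support. -/
theorem exists_mem_of_closed_cover_stdSimplex [Nonempty I] (F : I → Set (I → ℝ))
    (hF : ∀ i, IsClosed (F i)) (hcov : stdSimplex ℝ I ⊆ ⋃ i, F i) :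
    ∃ x ∈ stdSimplex ℝ I, ∀ i, 0 < x i → x ∈ F i := by
  classical
  by_contra! hcon
  -- A Lebesgue ball in the `i`th set cannot contain a point of `F i`, nor the point obtained by
  -- zeroing coordinate `i`, which need not lie in the simplex.
  obtain ⟨δ, hδ, hball⟩ := lebesgue_number_lemma_of_metric (c := fun i => {x | 0 < x i} ∩ (F i)ᶜ)
    (isCompact_stdSimplex ℝ I)
    (fun i => (isOpen_lt continuous_const (continuous_apply i)).inter (hF i).isOpen_compl)
    fun x hx => by
      obtain ⟨i, hi, hxi⟩ := hcon x hx
      exact Set.mem_iUnion.2 ⟨i, hi, hxi⟩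
  have hc : ∀ x, ∃ i, x ∈ stdSimplex ℝ I → x ∈ F i := fun x => by
    by_cases hx : x ∈ stdSimplex ℝ I
    · obtain ⟨i, hi⟩ := Set.mem_iUnion.1 (hcov hx)
      exact ⟨i, fun _ => hi⟩
    · exact ⟨Classical.arbitrary I, fun h => absurd h hx⟩
  choose c hc using hc
  obtain ⟨x, hx, hxi⟩ := exists_nearly_colourful_point c hδ
  obtain ⟨i, hi⟩ := hball x hx
  rcases hxi i with h | ⟨a, ha, rfl, hax⟩
  · have h1 : Function.update x i 0 ∈ Metric.ball x δ := by
      rw [Metric.mem_ball, dist_pi_lt_iff hδ]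
      intro j
      rcases eq_or_ne j i with rfl | hj
      · simpa [abs_of_nonneg (hx.1 j)] using h
      · simpa [hj] using hδ
    simpa using (hi h1).1
  · exact (hi (Metric.mem_ball.2 hax)).2 (hc a ha)

end DualKKM

/-! ### Self-segment-dense sets and convex hulls -/

section Density

variable {X : Type*} [AddCommGroup X] [Module ℝ X] [TopologicalSpace X]
  [IsTopologicalAddGroup X] [ContinuousSMul ℝ X]

lemma convex_closure_of_segment_subset_closure {s : Set X}
    (h : ∀ x ∈ s, ∀ y ∈ s, segment ℝ x y ⊆ closure s) : Convex ℝ (closure s) := by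
  intro x hx y hy a b ha hb hab
  rw [← closure_closure]
  exact map_mem_closure₂ (f := fun x y : X => a • x + b • y)
    (by simp only [Function.uncurry_def]; fun_prop) hx hy
    fun x hx y hy => h x hx y hy ⟨a, b, ha, hb, hab, rfl⟩

/-- The right-hand side is a convex set containing `s`, because segments between points of `D ∩
convexHull ℝ s` stay in the hull and meet `D` densely. -/
lemma IsSelfSegmentDense.convexHull_subset_closure {D K : Set X} (hD : IsSelfSegmentDense D K)
    {s : Set X} (hs : s ⊆ D) : convexHull ℝ s ⊆ closure (D ∩ convexHull ℝ s) := by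
  refine convexHull_min (fun x hx => subset_closure ⟨hs hx, subset_convexHull ℝ s hx⟩) ?_
  refine convex_closure_of_segment_subset_closure fun x hx y hy => ?_
  refine (hD.segment_dense x hx.1 y hy.1).trans (closure_mono fun z hz => ⟨hz.2, ?_⟩)
  exact (convex_convexHull ℝ s).segment_subset hx.2 hy.2 hz.1

end Density

/-! ### Cone order, semicontinuity and convexity -/

section Cone

variable {Z : Type*} [AddCommGroup Z] [Module ℝ Z] [TopologicalSpace Z]
  [IsTopologicalAddGroup Z]

lemma PointedCone.add_mem_neg_interior (C : PointedCone ℝ Z) {z w : Z}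
    (hz : z ∈ -interior (C : Set Z)) (hw : -w ∈ C) : z + w ∈ -interior (C : Set Z) := by
  have h : interior (C : Set Z) + (C : Set Z) ⊆ interior (C : Set Z) := by
    refine interior_maximal ?_ isOpen_interior.add_right
    rintro _ ⟨a, ha, b, hb, rfl⟩
    exact C.add_mem (interior_subset ha) hb
  rw [Set.mem_neg, neg_add]
  exact h ⟨-z, hz, -w, hw, rfl⟩

lemma IsConeUpperSemicontinuousAt.exists_neg_interior {X : Type*} [TopologicalSpace X]
    {C : PointedCone ℝ Z} {K : Set X} {g : X → Z} {x : X}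
    (h : IsConeUpperSemicontinuousAt (C : Set Z) K g x) (hx : g x ∈ -interior (C : Set Z)) :
    ∃ U, IsOpen U ∧ x ∈ U ∧ ∀ u ∈ U ∩ K, g u ∈ -interior (C : Set Z) := by
  obtain ⟨U, hU, hUK⟩ := h _ (isOpen_interior.neg.mem_nhds hx)
  obtain ⟨W, hWU, hW, hxW⟩ := mem_nhds_iff.1 hU
  refine ⟨W, hW, hxW, fun u hu => ?_⟩
  obtain ⟨z, hz, w, hw, hzw⟩ := hUK u ⟨hWU hu.1, hu.2⟩
  simp only at hzw
  rw [← hzw, sub_eq_add_neg]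
  exact C.add_mem_neg_interior hz (by simpa using hw)

lemma IsConeConvexOn.mem_neg_interior {X : Type*} [AddCommGroup X] [Module ℝ X]
    [ContinuousConstSMul ℝ Z]
    {C : PointedCone ℝ Z} {D : Set X} {g : X → Z} (h : IsConeConvexOn (C : Set Z) D g)
    {s : Set X} (hs : s ⊆ D) (hg : ∀ y ∈ s, g y ∈ -interior (C : Set Z))
    {x : X} (hx : x ∈ convexHull ℝ s) (hxD : x ∈ D) : g x ∈ -interior (C : Set Z) := by
  obtain ⟨ι, _, w, z, hw, hw1, hz, rfl⟩ := mem_convexHull_iff_exists_fintype.1 hx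
  let φ := (Fintype.equivFin ι).symm
  have hsumX : ∑ i, w (φ i) • z (φ i) = ∑ i, w i • z i := φ.sum_comp fun i => w i • z i
  have hsumZ : ∑ i, w (φ i) • g (z (φ i)) = ∑ i, w i • g (z i) :=
    φ.sum_comp fun i => w i • g (z i)
  have hC := h _ (fun i => z (φ i)) (fun i => w (φ i)) (fun i => hs (hz _)) (fun i => hw _)
    (by rw [← hw1]; exact φ.sum_comp w) (by rwa [hsumX])
  rw [hsumX, hsumZ] at hC
  have hconv : Convex ℝ (-interior (C : Set Z)) := C.convex.interior.neg
  have hmem : ∑ i, w i • g (z i) ∈ -interior (C : Set Z) :=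
    hconv.sum_mem (fun i _ => hw i) hw1 fun i _ => hg _ (hz i)
  have := C.add_mem_neg_interior hmem (w := g (∑ i, w i • z i) - ∑ i, w i • g (z i))
    (by simpa using hC)
  simpa using this

end Cone

/-! ### Intersection theorem and equilibrium point -/

/-- An intersection theorem for self-segment-dense sets: if the compact convex set `K` is covered by
open sets indexed by points of `D`, then some point of `D` is a convex combination of indices whose
open sets contain it. -/
theorem IsSelfSegmentDense.exists_mem_convexHull {X : Type*} [AddCommGroup X] [Module ℝ X]
    [TopologicalSpace X] [IsTopologicalAddGroup X] [ContinuousSMul ℝ X]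
    {D K : Set X} (hD : IsSelfSegmentDense D K) (hKne : K.Nonempty) (hKconv : Convex ℝ K)
    (hKcomp : IsCompact K) (O : D → Set X) (hO : ∀ y, IsOpen (O y)) (hcov : K ⊆ ⋃ y, O y) :
    ∃ s ⊆ D, ∃ x ∈ D, x ∈ convexHull ℝ s ∧ ∀ y (hy : y ∈ D), y ∈ s → x ∈ O ⟨y, hy⟩ := by
  classical
  obtain ⟨t, ht⟩ := hKcomp.elim_finite_subcover O hO hcov
  have : Nonempty t := by
    obtain ⟨x, hx⟩ := hKne
    obtain ⟨y, hy, -⟩ := Set.mem_iUnion₂.1 (ht hx)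
    exact ⟨⟨y, hy⟩⟩
  let Φ : (t → ℝ) → X := fun w => ∑ i, w i • (i.1.1 : X)
  have hΦ : Continuous Φ := by fun_prop
  have hΦK : ∀ w ∈ stdSimplex ℝ t, Φ w ∈ K := fun w hw =>
    hKconv.sum_mem (fun i _ => hw.1 i) hw.2 fun i _ => hD.subset i.1.2
  -- Dual KKM needs closed sets, so the open cover is shrunk; the open sets are used again to move
  -- the point into `D`.
  obtain ⟨F, hFcov, hFclosed, hFsub⟩ := exists_subset_iUnion_closed_subset
    (u := fun i : t => Φ ⁻¹' O i.1) (isCompact_stdSimplex ℝ t).isClosed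
    (fun i => (hO i.1).preimage hΦ) (fun _ _ => Set.toFinite _)
    fun w hw => by
      obtain ⟨y, hy, hyO⟩ := Set.mem_iUnion₂.1 (ht (hΦK w hw))
      exact Set.mem_iUnion.2 ⟨⟨y, hy⟩, hyO⟩
  obtain ⟨w, hw, hwF⟩ := exists_mem_of_closed_cover_stdSimplex F hFclosed hFcov
  let P : Finset t := Finset.univ.filter fun i => 0 < w i
  let s : Set X := (fun i : t => (i.1.1 : X)) '' P
  have hsD : s ⊆ D := by
    rintro _ ⟨i, -, rfl⟩
    exact i.1.2
  have hΦs : Φ w ∈ convexHull ℝ s := by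
    have hzero : ∀ i ∈ Finset.univ, i ∉ P → w i = 0 := fun i _ hi =>
      le_antisymm (not_lt.1 fun h => hi (by simpa [P] using h)) (hw.1 i)
    have h1 : Φ w = ∑ i ∈ P, w i • (i.1.1 : X) :=
      (Finset.sum_subset (Finset.subset_univ P)
        fun i hi hiP => by rw [hzero i hi hiP, zero_smul]).symm
    rw [h1]
    refine (convex_convexHull ℝ s).sum_mem (fun i _ => hw.1 i) ?_
      fun i hi => subset_convexHull ℝ s ⟨i, hi, rfl⟩
    rw [Finset.sum_subset (Finset.subset_univ P) hzero]
    exact hw.2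
  have hW : IsOpen (⋂ i ∈ P, O i.1) := isOpen_biInter_finset fun i _ => hO i.1
  have hxW : Φ w ∈ ⋂ i ∈ P, O i.1 := Set.mem_iInter₂.2 fun i hi =>
    hFsub i (hwF i (Finset.mem_filter.1 hi).2)
  obtain ⟨x, hxW, hxD, hxs⟩ :=
    mem_closure_iff.1 (hD.convexHull_subset_closure hsD hΦs) _ hW hxW
  refine ⟨s, hsD, x, hxD, hxs, ?_⟩
  rintro y hy ⟨i, hi, rfl⟩
  exact Set.mem_iInter₂.1 hxW i hi

/-- `PointedCone ℝ Z` is Mathlib's type of convex cones that contain `0`; the condition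
`C ∩ (-C) = {0}` is the hypothesis `hC`. -/
theorem theoremt1 {X Z : Type*}
    [AddCommGroup X] [Module ℝ X] [TopologicalSpace X] [IsTopologicalAddGroup X]
    [ContinuousSMul ℝ X] [LocallyConvexSpace ℝ X] [T2Space X]
    [AddCommGroup Z] [Module ℝ Z] [TopologicalSpace Z] [IsTopologicalAddGroup Z]
    [ContinuousSMul ℝ Z] [LocallyConvexSpace ℝ Z] [T2Space Z]
    (C : PointedCone ℝ Z) (hC : (C : Set Z) ∩ (-(C : Set Z)) = {0})
    (hCint : (interior (C : Set Z)).Nonempty)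
    (K : Set X) (hKne : K.Nonempty) (hKconv : Convex ℝ K) (hKcomp : IsCompact K)
    (D : Set X) (hD : IsSelfSegmentDense D K)
    (f : X → X → Z)
    (h1 : ∀ y ∈ D, ∀ x ∈ K, IsConeUpperSemicontinuousAt (C : Set Z) K (fun u => f u y) x)
    (h2 : ∀ x ∈ K, ∀ y ∈ K \ D, IsConeUpperSemicontinuousAt (C : Set Z) K (fun v => f x v) y)
    (h3 : ∀ x ∈ D, IsConeConvexOn (C : Set Z) D (fun y => f x y))
    (h4 : ∀ x ∈ D, f x x ∉ -interior (C : Set Z)) :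
    ∃ x₀ ∈ K, ∀ y ∈ K, f x₀ y ∉ -interior (C : Set Z) := by
  have hmain : ∃ x₀ ∈ K, ∀ y ∈ D, f x₀ y ∉ -interior (C : Set Z) := by
    by_contra! hcon
    -- Semicontinuity gives openness relative to `K` only; this union is open in `X`.
    let O : D → Set X := fun y =>
      ⋃₀ {U | IsOpen U ∧ ∀ u ∈ U ∩ K, f u y ∈ -interior (C : Set Z)}
    obtain ⟨s, hsD, x, hxD, hxs, hx⟩ := hD.exists_mem_convexHull hKne hKconv hKcomp O
      (fun y => isOpen_sUnion fun U hU => hU.1) fun x hx => by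
        obtain ⟨y, hy, hxy⟩ := hcon x hx
        obtain ⟨U, hU, hxU, hUK⟩ := (h1 y hy x hx).exists_neg_interior hxy
        exact Set.mem_iUnion.2 ⟨⟨y, hy⟩, U, ⟨hU, hUK⟩, hxU⟩
    refine h4 x hxD ((h3 x hxD).mem_neg_interior hsD (fun y hy => ?_) hxs hxD)
    obtain ⟨U, ⟨-, hU⟩, hxU⟩ := hx y (hsD hy) hy
    exact hU x ⟨hxU, hD.subset hxD⟩
  obtain ⟨x₀, hx₀, hx₀D⟩ := hmain
  refine ⟨x₀, hx₀, fun y hy hxy => ?_⟩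
  by_cases hyD : y ∈ D
  · exact hx₀D y hyD hxy
  obtain ⟨U, hU, hyU, hUK⟩ := (h2 x₀ hx₀ y ⟨hy, hyD⟩).exists_neg_interior hxy
  obtain ⟨u, huU, huD⟩ := mem_closure_iff.1 (hD.dense hy) U hU hyU
  exact hx₀D u huD (hUK u ⟨huU, hD.subset huD⟩)
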